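/- Let $\mathbf k$ be a commutative unital ring, for example a field. A $\Sigma$-module is a collection $E=\{E(n)\}_{n\ge 0}$ of right $\mathbf k[\Sigma_n]$-modules. A non-unital operad is a $\Sigma$-module $\mathcal S$ with $\mathbf k$-linear compositions $\circ_i:\mathcal S(m)\otimes\mathcal S(n)\to\mathcal S(m+n-1)$, $1\le i\le m$, $n\ge 0$, satisfying the usual associativity and equivariance axioms; a (unital) operad has in addition an element $e\in\mathcal S(1)$ with $f\circ_i e=f$ and $e\circ_1 g=g$ for all $f,g$ and $i$. Let $\Psi(E)$ and $\Gamma(E)$ denote the free non-unital operad and the free operad generated by a $\Sigma$-module $E$, i.e. the values at $E$ of the left adjoints of the forgetful functors from non-unital operads, respectively operads, to $\Sigma$-modules. Proposition. Let $E=\{E(n)\}_{n\ge 0}$ be a $\Sigma$-module such that $E(0)=E(1)=0$ and such that the $\mathbf k$-module $E(n)$ is finitely generated (finite-dimensional, if $\mathbf k$ is a field) for each $n\ge 2$. Then the $\mathbf k$-modules $\Psi(E)(n)$ and $\Gamma(E)(n)$ are finitely generated (finite-dimensional, if $\mathbf k$ is a field) for each $n\ge 0$. -/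

import Mathlib

universe u v w

/-- A `Σ`-module over `k`: a collection `E(n)`, `n ≥ 0`, of right `k[Σ_n]`-modules, i.e. of
`k`-modules with a `k`-linear right action of the symmetric group `Σ_n = Perm (Fin n)`
(a representation of the opposite group). -/
structure SigmaModule (k : Type u) [CommRing k] where
  carrier : ℕ → Type v
  [addCommGroup : ∀ n, AddCommGroup (carrier n)]
  [module : ∀ n, Module k (carrier n)]
  rightAction : ∀ n, Representation k (Equiv.Perm (Fin n))ᵐᵒᵖ (carrier n)

attribute [instance] SigmaModule.addCommGroup SigmaModule.module

namespace SigmaModule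

variable {k : Type u} [CommRing k]

/-- The right action `(f, σ) ↦ f σ` of the symmetric group. -/
def act (E : SigmaModule.{u, v} k) {n : ℕ} (σ : Equiv.Perm (Fin n)) :
    E.carrier n →ₗ[k] E.carrier n :=
  E.rightAction n (MulOpposite.op σ)

/-- A morphism of `Σ`-modules: a sequence of equivariant `k`-linear maps. -/
structure Hom (E : SigmaModule.{u, v} k) (F : SigmaModule.{u, w} k) where
  toFun : ∀ n, E.carrier n →ₗ[k] F.carrier n
  map_act : ∀ {n : ℕ} (σ : Equiv.Perm (Fin n)) (x : E.carrier n),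
    toFun n (E.act σ x) = F.act σ (toFun n x)

end SigmaModule

/-- Positions after insertion. Replacing the position `i` of `Fin m` by a block of `n` positions
gives `r = m + n - 1` positions: `p < i` stays where it is, `p > i` moves to `p + n - 1`, and the
`q`-th member of the block sits at `i + q`. -/
def insertPos {m n r : ℕ} (i : Fin m) (h : m + n = r + 1) :
    {p : Fin m // p ≠ i} ⊕ Fin n → Fin r
  | Sum.inl p => ⟨if p.1.val < i.val then p.1.val else p.1.val + n - 1, by
      have h1 := p.1.isLt
      have h2 := i.isLt
      have h3 : p.1.val ≠ i.val := fun e => p.2 (Fin.ext e)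
      split_ifs <;> omega⟩
  | Sum.inr q => ⟨i.val + q.val, by
      have h1 := i.isLt
      have h2 := q.isLt
      omega⟩

theorem insertPos_bijective {m n r : ℕ} (i : Fin m) (h : m + n = r + 1) :
    Function.Bijective (insertPos i h) := by
  rw [Fintype.bijective_iff_injective_and_card]
  constructor
  · rintro (⟨p, hp⟩ | q) (⟨p', hp'⟩ | q') e
    · have h3 : p.val ≠ i.val := fun e => hp (Fin.ext e)
      have h4 : p'.val ≠ i.val := fun e => hp' (Fin.ext e)
      simp only [insertPos, Fin.mk.injEq] at e
      have : p = p' := by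
        apply Fin.ext
        split_ifs at e <;> omega
      subst this
      rfl
    · have h3 : p.val ≠ i.val := fun e => hp (Fin.ext e)
      simp only [insertPos, Fin.mk.injEq] at e
      have := q'.isLt
      split_ifs at e <;> omega
    · have h4 : p'.val ≠ i.val := fun e => hp' (Fin.ext e)
      simp only [insertPos, Fin.mk.injEq] at e
      have := q.isLt
      split_ifs at e <;> omega
    · simp only [insertPos, Fin.mk.injEq] at e
      have : q = q' := Fin.ext (by omega)
      rw [this]
  · have := i.isLt
    simp [Fintype.card_subtype_compl]
    omega

/-- `insertPos` as a bijection. -/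
noncomputable def insertEquiv {m n r : ℕ} (i : Fin m) (h : m + n = r + 1) :
    {p : Fin m // p ≠ i} ⊕ Fin n ≃ Fin r :=
  Equiv.ofBijective (insertPos i h) (insertPos_bijective i h)

/-- The permutation `τ ∘_i σ` of `m + n - 1` letters obtained by inserting `σ` at the `i`-th place
of `τ`: the block inserted at `i` goes to the block inserted at `τ i`, permuted by `σ` inside, and
the remaining letters are permuted as by `τ`. -/
noncomputable def insertPerm {m n r : ℕ} (i : Fin m) (h : m + n = r + 1)
    (τ : Equiv.Perm (Fin m)) (σ : Equiv.Perm (Fin n)) : Equiv.Perm (Fin r) :=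
  (insertEquiv i h).symm.trans
    ((Equiv.sumCongr (τ.subtypeEquiv (fun p => (τ.injective.ne_iff (x := p) (y := i)).symm))
      σ).trans (insertEquiv (τ i) h))

/-- A non-unital (Markl) operad in `k`-modules: a `Σ`-module with `k`-bilinear compositions
`∘_i : P(m) ⊗ P(n) → P(m + n - 1)`. Inputs are numbered from `0`, so `i : Fin m`, and the arity
`r = m + n - 1` of the composite is given by the equation `m + n = r + 1`. -/
structure NonunitalOperad (k : Type u) [CommRing k] extends SigmaModule.{u, v} k where
  comp : ∀ {m n r : ℕ} (_ : Fin m) (_ : m + n = r + 1),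
    carrier m →ₗ[k] carrier n →ₗ[k] carrier r
  /-- `(f ∘_j g) ∘_i h = (f ∘_i h) ∘_{j+c-1} g` if `i < j`. -/
  assoc_lt : ∀ {a b c p q r : ℕ} (hab : a + b = p + 1) (hpc : p + c = r + 1)
    (hac : a + c = q + 1) (hqb : q + b = r + 1) (j : Fin a) (i : Fin p) (i' : Fin a) (j' : Fin q),
    i.val < j.val → i'.val = i.val → j'.val + 1 = j.val + c →
    ∀ (f : carrier a) (g : carrier b) (h : carrier c),
      comp i hpc (comp j hab f g) h = comp j' hqb (comp i' hac f h) g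
  /-- `(f ∘_j g) ∘_i h = f ∘_j (g ∘_{i-j} h)` if `j ≤ i < j + b`. -/
  assoc_mid : ∀ {a b c p q r : ℕ} (hab : a + b = p + 1) (hpc : p + c = r + 1)
    (hbc : b + c = q + 1) (haq : a + q = r + 1) (j : Fin a) (i : Fin p) (i' : Fin b),
    i.val = j.val + i'.val →
    ∀ (f : carrier a) (g : carrier b) (h : carrier c),
      comp i hpc (comp j hab f g) h = comp j haq f (comp i' hbc g h)
  /-- `(f ∘_j g) ∘_i h = (f ∘_{i-b+1} h) ∘_j g` if `j + b ≤ i`. -/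
  assoc_gt : ∀ {a b c p q r : ℕ} (hab : a + b = p + 1) (hpc : p + c = r + 1)
    (hac : a + c = q + 1) (hqb : q + b = r + 1) (j : Fin a) (i : Fin p) (i' : Fin a) (j' : Fin q),
    j.val + b ≤ i.val → i'.val + b = i.val + 1 → j'.val = j.val →
    ∀ (f : carrier a) (g : carrier b) (h : carrier c),
      comp i hpc (comp j hab f g) h = comp j' hqb (comp i' hac f h) g
  /-- `(f τ) ∘_i (g σ) = (f ∘_{τ(i)} g) (τ ∘_i σ)`. -/
  equivariance : ∀ {m n r : ℕ} (h : m + n = r + 1) (i : Fin m) (τ : Equiv.Perm (Fin m))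
    (σ : Equiv.Perm (Fin n)) (f : carrier m) (g : carrier n),
    comp i h (toSigmaModule.act τ f) (toSigmaModule.act σ g) =
      toSigmaModule.act (insertPerm i h τ σ) (comp (τ i) h f g)

/-- A morphism of non-unital operads. -/
structure NonunitalOperad.Hom {k : Type u} [CommRing k] (P : NonunitalOperad.{u, v} k)
    (Q : NonunitalOperad.{u, w} k) extends
    toSigmaHom : SigmaModule.Hom P.toSigmaModule Q.toSigmaModule where
  map_comp : ∀ {m n r : ℕ} (i : Fin m) (h : m + n = r + 1) (f : P.carrier m) (g : P.carrier n),
    toFun r (P.comp i h f g) = Q.comp i h (toFun m f) (toFun n g)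

/-- An operad in `k`-modules (with unit): a non-unital operad together with `e ∈ P(1)` such that
`f ∘_i e = f` and `e ∘_1 g = g`. -/
structure Operad (k : Type u) [CommRing k] extends NonunitalOperad.{u, v} k where
  one : carrier 1
  comp_one : ∀ {m : ℕ} (i : Fin m) (f : carrier m), comp i rfl f one = f
  one_comp : ∀ {n : ℕ} (g : carrier n), comp (0 : Fin 1) (Nat.add_comm 1 n) one g = g

/-- A morphism of operads. -/
structure Operad.Hom {k : Type u} [CommRing k] (P : Operad.{u, v} k)
    (Q : Operad.{u, w} k) extends
    toNonunitalHom : NonunitalOperad.Hom P.toNonunitalOperad Q.toNonunitalOperad where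
  map_one : toFun 1 P.one = Q.one

namespace SigmaModule

variable {k : Type u} [CommRing k]

/-- Formal expressions of arity `n` built from elements of `E` with the operations of an operad.
A formal unit is available iff `U` holds, so that `U = False` and `U = True` give the expressions
in the language of non-unital and of unital operads. -/
inductive Formal (E : SigmaModule.{u, v} k) (U : Prop) : ℕ → Type (max u v)
  | of {n : ℕ} (x : E.carrier n) : Formal E U n
  | one (hU : U) : Formal E U 1
  | zero {n : ℕ} : Formal E U n
  | add {n : ℕ} (f g : Formal E U n) : Formal E U n
  | smul {n : ℕ} (c : k) (f : Formal E U n) : Formal E U n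
  | act {n : ℕ} (σ : Equiv.Perm (Fin n)) (f : Formal E U n) : Formal E U n
  | comp {m n r : ℕ} (i : Fin m) (h : m + n = r + 1) (f : Formal E U m) (g : Formal E U n) :
      Formal E U r

/-- The congruence generated by the axioms of a `k`-linear operad (unital iff `U` holds) and by
the requirement that `Formal.of` be `k`-linear and equivariant. -/
inductive Formal.Rel (E : SigmaModule.{u, v} k) (U : Prop) :
    ∀ {n : ℕ}, Formal E U n → Formal E U n → Prop
  -- equivalence relation
  | refl {n : ℕ} (f : Formal E U n) : Formal.Rel E U f f
  | symm {n : ℕ} {f g : Formal E U n} : Formal.Rel E U f g → Formal.Rel E U g f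
  | trans {n : ℕ} {f g h : Formal E U n} :
      Formal.Rel E U f g → Formal.Rel E U g h → Formal.Rel E U f h
  -- compatibility with the operations
  | add_congr {n : ℕ} {f f' g g' : Formal E U n} :
      Formal.Rel E U f f' → Formal.Rel E U g g' → Formal.Rel E U (f.add g) (f'.add g')
  | smul_congr {n : ℕ} (c : k) {f f' : Formal E U n} :
      Formal.Rel E U f f' → Formal.Rel E U (f.smul c) (f'.smul c)
  | act_congr {n : ℕ} (σ : Equiv.Perm (Fin n)) {f f' : Formal E U n} :
      Formal.Rel E U f f' → Formal.Rel E U (f.act σ) (f'.act σ)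
  | comp_congr {m n r : ℕ} (i : Fin m) (h : m + n = r + 1) {f f' : Formal E U m}
      {g g' : Formal E U n} : Formal.Rel E U f f' → Formal.Rel E U g g' →
      Formal.Rel E U (Formal.comp i h f g) (Formal.comp i h f' g')
  -- `k`-module axioms
  | add_assoc {n : ℕ} (f g h : Formal E U n) :
      Formal.Rel E U ((f.add g).add h) (f.add (g.add h))
  | add_comm {n : ℕ} (f g : Formal E U n) : Formal.Rel E U (f.add g) (g.add f)
  | zero_add {n : ℕ} (f : Formal E U n) : Formal.Rel E U (Formal.zero.add f) f
  | one_smul {n : ℕ} (f : Formal E U n) : Formal.Rel E U (f.smul 1) f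
  | mul_smul {n : ℕ} (c d : k) (f : Formal E U n) :
      Formal.Rel E U (f.smul (c * d)) ((f.smul d).smul c)
  | smul_add {n : ℕ} (c : k) (f g : Formal E U n) :
      Formal.Rel E U ((f.add g).smul c) ((f.smul c).add (g.smul c))
  | add_smul {n : ℕ} (c d : k) (f : Formal E U n) :
      Formal.Rel E U (f.smul (c + d)) ((f.smul c).add (f.smul d))
  | zero_smul {n : ℕ} (f : Formal E U n) : Formal.Rel E U (f.smul 0) Formal.zero
  -- the generators form a `Σ`-module
  | of_add {n : ℕ} (x y : E.carrier n) :
      Formal.Rel E U (Formal.of (x + y)) ((Formal.of x).add (Formal.of y))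
  | of_smul {n : ℕ} (c : k) (x : E.carrier n) :
      Formal.Rel E U (Formal.of (c • x)) ((Formal.of x).smul c)
  | of_act {n : ℕ} (σ : Equiv.Perm (Fin n)) (x : E.carrier n) :
      Formal.Rel E U (Formal.of (E.act σ x)) ((Formal.of x).act σ)
  -- linear right action
  | act_add {n : ℕ} (σ : Equiv.Perm (Fin n)) (f g : Formal E U n) :
      Formal.Rel E U ((f.add g).act σ) ((f.act σ).add (g.act σ))
  | act_smul {n : ℕ} (σ : Equiv.Perm (Fin n)) (c : k) (f : Formal E U n) :
      Formal.Rel E U ((f.smul c).act σ) ((f.act σ).smul c)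
  | act_one {n : ℕ} (f : Formal E U n) : Formal.Rel E U (f.act 1) f
  | act_mul {n : ℕ} (σ τ : Equiv.Perm (Fin n)) (f : Formal E U n) :
      Formal.Rel E U (f.act (σ * τ)) ((f.act σ).act τ)
  -- bilinearity of the compositions
  | comp_add_left {m n r : ℕ} (i : Fin m) (h : m + n = r + 1) (f f' : Formal E U m)
      (g : Formal E U n) : Formal.Rel E U (Formal.comp i h (f.add f') g)
        ((Formal.comp i h f g).add (Formal.comp i h f' g))
  | comp_smul_left {m n r : ℕ} (i : Fin m) (h : m + n = r + 1) (c : k) (f : Formal E U m)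
      (g : Formal E U n) : Formal.Rel E U (Formal.comp i h (f.smul c) g)
        ((Formal.comp i h f g).smul c)
  | comp_add_right {m n r : ℕ} (i : Fin m) (h : m + n = r + 1) (f : Formal E U m)
      (g g' : Formal E U n) : Formal.Rel E U (Formal.comp i h f (g.add g'))
        ((Formal.comp i h f g).add (Formal.comp i h f g'))
  | comp_smul_right {m n r : ℕ} (i : Fin m) (h : m + n = r + 1) (c : k) (f : Formal E U m)
      (g : Formal E U n) : Formal.Rel E U (Formal.comp i h f (g.smul c))
        ((Formal.comp i h f g).smul c)
  -- associativity, equivariance and unitality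
  | assoc_lt {a b c p q r : ℕ} (hab : a + b = p + 1) (hpc : p + c = r + 1)
      (hac : a + c = q + 1) (hqb : q + b = r + 1) (j : Fin a) (i : Fin p) (i' : Fin a)
      (j' : Fin q) (_ : i.val < j.val) (_ : i'.val = i.val) (_ : j'.val + 1 = j.val + c)
      (f : Formal E U a) (g : Formal E U b) (h : Formal E U c) :
      Formal.Rel E U (Formal.comp i hpc (Formal.comp j hab f g) h)
        (Formal.comp j' hqb (Formal.comp i' hac f h) g)
  | assoc_mid {a b c p q r : ℕ} (hab : a + b = p + 1) (hpc : p + c = r + 1)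
      (hbc : b + c = q + 1) (haq : a + q = r + 1) (j : Fin a) (i : Fin p) (i' : Fin b)
      (_ : i.val = j.val + i'.val)
      (f : Formal E U a) (g : Formal E U b) (h : Formal E U c) :
      Formal.Rel E U (Formal.comp i hpc (Formal.comp j hab f g) h)
        (Formal.comp j haq f (Formal.comp i' hbc g h))
  | assoc_gt {a b c p q r : ℕ} (hab : a + b = p + 1) (hpc : p + c = r + 1)
      (hac : a + c = q + 1) (hqb : q + b = r + 1) (j : Fin a) (i : Fin p) (i' : Fin a)
      (j' : Fin q) (_ : j.val + b ≤ i.val) (_ : i'.val + b = i.val + 1) (_ : j'.val = j.val)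
      (f : Formal E U a) (g : Formal E U b) (h : Formal E U c) :
      Formal.Rel E U (Formal.comp i hpc (Formal.comp j hab f g) h)
        (Formal.comp j' hqb (Formal.comp i' hac f h) g)
  | equivariance {m n r : ℕ} (h : m + n = r + 1) (i : Fin m) (τ : Equiv.Perm (Fin m))
      (σ : Equiv.Perm (Fin n)) (f : Formal E U m) (g : Formal E U n) :
      Formal.Rel E U (Formal.comp i h (f.act τ) (g.act σ))
        ((Formal.comp (τ i) h f g).act (insertPerm i h τ σ))
  | comp_one (hU : U) {m : ℕ} (i : Fin m) (f : Formal E U m) :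
      Formal.Rel E U (Formal.comp i rfl f (Formal.one hU)) f
  | one_comp (hU : U) {n : ℕ} (g : Formal E U n) :
      Formal.Rel E U (Formal.comp (0 : Fin 1) (Nat.add_comm 1 n) (Formal.one hU) g) g

/-- The equivalence relation `Formal.Rel` on expressions of arity `n`. -/
def Formal.setoid (E : SigmaModule.{u, v} k) (U : Prop) (n : ℕ) : Setoid (Formal E U n) where
  r := Formal.Rel E U
  iseqv := ⟨Formal.Rel.refl, Formal.Rel.symm, Formal.Rel.trans⟩

/-- Formal expressions of arity `n` modulo the axioms. -/
def FreeCarrier (E : SigmaModule.{u, v} k) (U : Prop) (n : ℕ) : Type (max u v) :=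
  Quotient (Formal.setoid E U n)

namespace FreeCarrier

variable (E : SigmaModule.{u, v} k) (U : Prop)

instance add (n : ℕ) : Add (FreeCarrier E U n) where
  add := Quotient.map₂ Formal.add (fun _ _ h _ _ h' => Formal.Rel.add_congr h h')

instance zero (n : ℕ) : Zero (FreeCarrier E U n) where
  zero := Quotient.mk (Formal.setoid E U n) Formal.zero

instance addCommMonoid (n : ℕ) : AddCommMonoid (FreeCarrier E U n) where
  add_assoc := by
    rintro ⟨f⟩ ⟨g⟩ ⟨h⟩
    exact Quotient.sound (Formal.Rel.add_assoc f g h)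
  add_comm := by
    rintro ⟨f⟩ ⟨g⟩
    exact Quotient.sound (Formal.Rel.add_comm f g)
  zero_add := by
    rintro ⟨f⟩
    exact Quotient.sound (Formal.Rel.zero_add f)
  add_zero := by
    rintro ⟨f⟩
    exact Quotient.sound ((Formal.Rel.add_comm f _).trans (Formal.Rel.zero_add f))
  nsmul := nsmulRec

instance module (n : ℕ) : Module k (FreeCarrier E U n) where
  smul c := Quotient.map (Formal.smul c) (fun _ _ h => Formal.Rel.smul_congr c h)
  one_smul := by
    rintro ⟨f⟩
    exact Quotient.sound (Formal.Rel.one_smul f)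
  mul_smul := by
    rintro c d ⟨f⟩
    exact Quotient.sound (Formal.Rel.mul_smul c d f)
  smul_zero := by
    intro c
    refine Quotient.sound ((Formal.Rel.smul_congr c (Formal.Rel.zero_smul Formal.zero).symm).trans
      ((Formal.Rel.mul_smul c 0 Formal.zero).symm.trans ?_))
    rw [mul_zero]
    exact Formal.Rel.zero_smul _
  smul_add := by
    rintro c ⟨f⟩ ⟨g⟩
    exact Quotient.sound (Formal.Rel.smul_add c f g)
  add_smul := by
    rintro c d ⟨f⟩
    exact Quotient.sound (Formal.Rel.add_smul c d f)
  zero_smul := by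
    rintro ⟨f⟩
    exact Quotient.sound (Formal.Rel.zero_smul f)

instance addCommGroup (n : ℕ) : AddCommGroup (FreeCarrier E U n) :=
  Module.addCommMonoidToAddCommGroup k

/-- The action of a permutation on classes of expressions. -/
def actHom {n : ℕ} (σ : Equiv.Perm (Fin n)) : FreeCarrier E U n →ₗ[k] FreeCarrier E U n where
  toFun := Quotient.map (Formal.act σ) (fun _ _ h => Formal.Rel.act_congr σ h)
  map_add' := by
    rintro ⟨f⟩ ⟨g⟩
    exact Quotient.sound (Formal.Rel.act_add σ f g)
  map_smul' := by
    rintro c ⟨f⟩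
    exact Quotient.sound (Formal.Rel.act_smul σ c f)

/-- The composition `∘_i` on classes of expressions. -/
def compHom {m n r : ℕ} (i : Fin m) (h : m + n = r + 1) :
    FreeCarrier E U m →ₗ[k] FreeCarrier E U n →ₗ[k] FreeCarrier E U r :=
  LinearMap.mk₂ k
    (Quotient.map₂ (Formal.comp i h) (fun _ _ hf _ _ hg => Formal.Rel.comp_congr i h hf hg))
    (by
      rintro ⟨f⟩ ⟨f'⟩ ⟨g⟩
      exact Quotient.sound (Formal.Rel.comp_add_left i h f f' g))
    (by
      rintro c ⟨f⟩ ⟨g⟩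
      exact Quotient.sound (Formal.Rel.comp_smul_left i h c f g))
    (by
      rintro ⟨f⟩ ⟨g⟩ ⟨g'⟩
      exact Quotient.sound (Formal.Rel.comp_add_right i h f g g'))
    (by
      rintro c ⟨f⟩ ⟨g⟩
      exact Quotient.sound (Formal.Rel.comp_smul_right i h c f g))

/-- The `Σ`-module of classes of expressions. -/
def sigmaModule : SigmaModule.{u, max u v} k where
  carrier := FreeCarrier E U
  rightAction n :=
    { toFun := fun σ => actHom E U σ.unop
      map_one' := by
        ext ⟨f⟩
        exact Quotient.sound (Formal.Rel.act_one f)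
      map_mul' := by
        intro σ τ
        ext ⟨f⟩
        exact Quotient.sound (Formal.Rel.act_mul τ.unop σ.unop f) }

/-- The non-unital operad of classes of expressions. -/
def nonunitalOperad : NonunitalOperad.{u, max u v} k where
  toSigmaModule := sigmaModule E U
  comp i h := compHom E U i h
  assoc_lt := by
    rintro a b c p q r hab hpc hac hqb j i i' j' h1 h2 h3 ⟨f⟩ ⟨g⟩ ⟨h⟩
    exact Quotient.sound (Formal.Rel.assoc_lt hab hpc hac hqb j i i' j' h1 h2 h3 f g h)
  assoc_mid := by
    rintro a b c p q r hab hpc hbc haq j i i' h1 ⟨f⟩ ⟨g⟩ ⟨h⟩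
    exact Quotient.sound (Formal.Rel.assoc_mid hab hpc hbc haq j i i' h1 f g h)
  assoc_gt := by
    rintro a b c p q r hab hpc hac hqb j i i' j' h1 h2 h3 ⟨f⟩ ⟨g⟩ ⟨h⟩
    exact Quotient.sound (Formal.Rel.assoc_gt hab hpc hac hqb j i i' j' h1 h2 h3 f g h)
  equivariance := by
    rintro m n r h i τ σ ⟨f⟩ ⟨g⟩
    exact Quotient.sound (Formal.Rel.equivariance h i τ σ f g)

/-- The class of a generator. -/
def ι : SigmaModule.Hom E (sigmaModule E U) where
  toFun n :=
    { toFun := fun x => Quotient.mk (Formal.setoid E U n) (Formal.of x)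
      map_add' := fun x y => Quotient.sound (Formal.Rel.of_add x y)
      map_smul' := fun c x => Quotient.sound (Formal.Rel.of_smul c x) }
  map_act σ x := Quotient.sound (Formal.Rel.of_act σ x)

end FreeCarrier

/-- `Ψ(E)`, the free non-unital operad generated by the `Σ`-module `E`: all formal
`∘_i`-compositions of elements of `E`, modulo the axioms of a non-unital operad. -/
def freeNonunitalOperad (E : SigmaModule.{u, v} k) : NonunitalOperad.{u, max u v} k :=
  FreeCarrier.nonunitalOperad E False

/-- The canonical map `E → Ψ(E)`. -/
def toFreeNonunitalOperad (E : SigmaModule.{u, v} k) :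
    SigmaModule.Hom E E.freeNonunitalOperad.toSigmaModule :=
  FreeCarrier.ι E False

/-- `Γ(E)`, the free (unital) operad generated by the `Σ`-module `E`: all formal
compositions of elements of `E` and of a formal unit, modulo the axioms of an operad. -/
def freeOperad (E : SigmaModule.{u, v} k) : Operad.{u, max u v} k where
  toNonunitalOperad := FreeCarrier.nonunitalOperad E True
  one := Quotient.mk (Formal.setoid E True 1) (Formal.one trivial)
  comp_one := by
    rintro m i ⟨f⟩
    exact Quotient.sound (Formal.Rel.comp_one trivial i f)
  one_comp := by
    rintro n ⟨g⟩
    exact Quotient.sound (Formal.Rel.one_comp trivial g)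

/-- The canonical map `E → Γ(E)`. -/
def toFreeOperad (E : SigmaModule.{u, v} k) :
    SigmaModule.Hom E E.freeOperad.toSigmaModule :=
  FreeCarrier.ι E True

/-! The universal properties: `Ψ` and `Γ` are left adjoint to the forgetful functors. -/

/-- Evaluation of a formal expression in a non-unital operad, along a map of `Σ`-modules and an
interpretation `e` of the formal unit. -/
def Formal.eval {E : SigmaModule.{u, v} k} {U : Prop} {P : NonunitalOperad.{u, w} k}
    (φ : SigmaModule.Hom E P.toSigmaModule) (e : U → P.carrier 1) :
    ∀ {n : ℕ}, Formal E U n → P.carrier n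
  | _, .of x => φ.toFun _ x
  | _, .one hU => e hU
  | _, .zero => 0
  | _, .add f g => Formal.eval φ e f + Formal.eval φ e g
  | _, .smul c f => c • Formal.eval φ e f
  | _, .act σ f => P.act σ (Formal.eval φ e f)
  | _, .comp i h f g => P.comp i h (Formal.eval φ e f) (Formal.eval φ e g)

theorem Formal.eval_eq_of_rel {E : SigmaModule.{u, v} k} {U : Prop}
    {P : NonunitalOperad.{u, w} k}
    (φ : SigmaModule.Hom E P.toSigmaModule) (e : U → P.carrier 1)
    (he1 : ∀ (hU : U) {m : ℕ} (i : Fin m) (f : P.carrier m), P.comp i rfl f (e hU) = f)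
    (he2 : ∀ (hU : U) {n : ℕ} (g : P.carrier n),
      P.comp (0 : Fin 1) (Nat.add_comm 1 n) (e hU) g = g)
    {n : ℕ} {f g : Formal E U n} (h : Formal.Rel E U f g) :
    Formal.eval φ e f = Formal.eval φ e g := by
  induction h with
  | refl => rfl
  | symm _ ih => exact ih.symm
  | trans _ _ ih1 ih2 => exact ih1.trans ih2
  | add_congr _ _ ih1 ih2 => simp only [Formal.eval, ih1, ih2]
  | smul_congr c _ ih => simp only [Formal.eval, ih]
  | act_congr σ _ ih => simp only [Formal.eval, ih]
  | comp_congr i h _ _ ih1 ih2 => simp only [Formal.eval, ih1, ih2]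
  | add_assoc => exact _root_.add_assoc _ _ _
  | add_comm => exact _root_.add_comm _ _
  | zero_add => exact _root_.zero_add _
  | one_smul => exact _root_.one_smul _ _
  | mul_smul => exact SemigroupAction.mul_smul _ _ _
  | smul_add => exact _root_.smul_add _ _ _
  | add_smul => exact _root_.add_smul _ _ _
  | zero_smul => exact _root_.zero_smul _ _
  | of_add => exact map_add _ _ _
  | of_smul => exact map_smul _ _ _
  | of_act σ x => exact φ.map_act σ x
  | act_add => exact map_add _ _ _
  | act_smul => exact map_smul _ _ _
  | act_one f =>
    simp only [Formal.eval, SigmaModule.act, MulOpposite.op_one, map_one, Module.End.one_apply]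
  | act_mul σ τ f =>
    simp only [Formal.eval, SigmaModule.act, MulOpposite.op_mul, map_mul, Module.End.mul_apply]
  | comp_add_left => simp only [Formal.eval, map_add, LinearMap.add_apply]
  | comp_smul_left => simp only [Formal.eval, map_smul, LinearMap.smul_apply]
  | comp_add_right => simp only [Formal.eval, map_add]
  | comp_smul_right => simp only [Formal.eval, map_smul]
  | assoc_lt hab hpc hac hqb j i i' j' h1 h2 h3 f g h =>
    exact P.assoc_lt hab hpc hac hqb j i i' j' h1 h2 h3 _ _ _
  | assoc_mid hab hpc hbc haq j i i' h1 f g h =>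
    exact P.assoc_mid hab hpc hbc haq j i i' h1 _ _ _
  | assoc_gt hab hpc hac hqb j i i' j' h1 h2 h3 f g h =>
    exact P.assoc_gt hab hpc hac hqb j i i' j' h1 h2 h3 _ _ _
  | equivariance h i τ σ f g => exact P.equivariance h i τ σ _ _
  | comp_one hU i f => exact he1 hU i _
  | one_comp hU g => exact he2 hU _

/-- The morphism of non-unital operads induced by evaluation. -/
def FreeCarrier.lift {E : SigmaModule.{u, v} k} {U : Prop}
    {P : NonunitalOperad.{u, w} k}
    (φ : SigmaModule.Hom E P.toSigmaModule) (e : U → P.carrier 1)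
    (he1 : ∀ (hU : U) {m : ℕ} (i : Fin m) (f : P.carrier m), P.comp i rfl f (e hU) = f)
    (he2 : ∀ (hU : U) {n : ℕ} (g : P.carrier n),
      P.comp (0 : Fin 1) (Nat.add_comm 1 n) (e hU) g = g) :
    NonunitalOperad.Hom (FreeCarrier.nonunitalOperad E U) P where
  toFun n :=
    { toFun := Quotient.lift (Formal.eval φ e)
        (fun _ _ h => Formal.eval_eq_of_rel φ e he1 he2 h)
      map_add' := by
        rintro ⟨f⟩ ⟨g⟩
        rfl
      map_smul' := by
        rintro c ⟨f⟩
        rfl }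
  map_act := by
    rintro n σ ⟨f⟩
    rfl
  map_comp := by
    rintro m n r i h ⟨f⟩ ⟨g⟩
    rfl

theorem FreeCarrier.hom_ext {E : SigmaModule.{u, v} k} {U : Prop}
    {P : NonunitalOperad.{u, w} k}
    (α β : NonunitalOperad.Hom (FreeCarrier.nonunitalOperad E U) P)
    (hof : ∀ {n : ℕ} (x : E.carrier n),
      α.toFun n ((FreeCarrier.ι E U).toFun n x) = β.toFun n ((FreeCarrier.ι E U).toFun n x))
    (hone : ∀ hU : U, α.toFun 1 (Quotient.mk (Formal.setoid E U 1) (Formal.one hU)) =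
      β.toFun 1 (Quotient.mk (Formal.setoid E U 1) (Formal.one hU))) : α = β := by
  have key : ∀ {n : ℕ} (f : Formal E U n),
      α.toFun n (Quotient.mk (Formal.setoid E U n) f) =
        β.toFun n (Quotient.mk (Formal.setoid E U n) f) := by
    intro n f
    induction f with
    | of x => exact hof x
    | one hU => exact hone hU
    | zero => exact (map_zero (α.toFun _)).trans (map_zero (β.toFun _)).symm
    | add f g hf hg =>
      exact ((map_add (α.toFun _) _ _).trans (congrArg₂ _ hf hg)).trans
        (map_add (β.toFun _) _ _).symm
    | smul c f hf =>
      exact ((map_smul (α.toFun _) c _).trans (congrArg _ hf)).trans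
        (map_smul (β.toFun _) c _).symm
    | act σ f hf =>
      exact ((α.map_act σ _).trans (congrArg _ hf)).trans (β.map_act σ _).symm
    | comp i h f g hf hg =>
      have h1 := α.map_comp i h (Quotient.mk (Formal.setoid E U _) f)
        (Quotient.mk (Formal.setoid E U _) g)
      have h2 := β.map_comp i h (Quotient.mk (Formal.setoid E U _) f)
        (Quotient.mk (Formal.setoid E U _) g)
      rw [hf, hg] at h1
      exact h1.trans h2.symm
  obtain ⟨⟨a, _⟩, _⟩ := α
  obtain ⟨⟨b, _⟩, _⟩ := β
  have : a = b := by
    funext n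
    ext ⟨f⟩
    exact key f
  subst this
  rfl

/-- Universal property of `Ψ(E)`: every map of `Σ`-modules from `E` to a non-unital operad
extends uniquely to a morphism of non-unital operads on `Ψ(E)`. -/
theorem freeNonunitalOperad_universal (E : SigmaModule.{u, v} k) (P : NonunitalOperad.{u, w} k)
    (φ : SigmaModule.Hom E P.toSigmaModule) :
    ∃! α : NonunitalOperad.Hom E.freeNonunitalOperad P,
      ∀ (n : ℕ) (x : E.carrier n), α.toFun n (E.toFreeNonunitalOperad.toFun n x) = φ.toFun n x := by
  refine ⟨FreeCarrier.lift φ (fun h => h.elim) (fun h => h.elim) (fun h => h.elim),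
    fun n x => rfl, fun β hβ => ?_⟩
  exact FreeCarrier.hom_ext _ _ (fun x => hβ _ x) (fun h => h.elim)

/-- Universal property of `Γ(E)`: every map of `Σ`-modules from `E` to an operad
extends uniquely to a morphism of operads on `Γ(E)`. -/
theorem freeOperad_universal (E : SigmaModule.{u, v} k) (P : Operad.{u, w} k)
    (φ : SigmaModule.Hom E P.toSigmaModule) :
    ∃! α : Operad.Hom E.freeOperad P,
      ∀ (n : ℕ) (x : E.carrier n), α.toFun n (E.toFreeOperad.toFun n x) = φ.toFun n x := by
  refine ⟨⟨FreeCarrier.lift (P := P.toNonunitalOperad) φ (fun _ => P.one)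
    (fun _ => P.comp_one) (fun _ => P.one_comp), rfl⟩, fun n x => rfl, fun β hβ => ?_⟩
  obtain ⟨β', hβ'⟩ := β
  congr 1
  exact FreeCarrier.hom_ext _ _ (fun x => hβ _ x) (fun _ => hβ')

end SigmaModule

/-! Compositions of operations of arity at least two strictly raise arity: if `m, n ≥ 2` and `m + n
= r + 1`, then `m, n < r`. Call an element of arity `r` decomposable if it is a sum of permuted
composites of this kind. There are finitely many choices of `m`, `n`, the slot `i` and the
permutation. So if all lower arities are finitely generated, the decomposables of arity `r` are too
(`decomposables_fg`).

It remains to see that nothing else is needed. By `Formal.eval_mem_valueSpan`, every formal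
expression has value zero in arity 0, a multiple of the unit (if there is one) in arity 1, and a
generator plus a decomposable in arity at least 2. The vanishing of `E(0)` and `E(1)` enters here:
nullary operations would let compositions lower arity, and unary ones could be composed indefinitely
without raising it. In the free operads every element is the value of an expression, and strong
induction on the arity concludes.

No basis of trees is required. Only images and finite sums of finitely generated modules occur,
never arbitrary submodules of them, so `k` need not be Noetherian. -/

namespace NonunitalOperad

/-! ### Decomposable elements -/

variable {k : Type u} [CommRing k]

/-- Elements of arity `r` obtained by permuting the inputs of a composition of two elements of
arity at least two. -/
def decomposables (P : NonunitalOperad.{u, w} k) (r : ℕ) : Submodule k (P.carrier r) :=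
  -- Taking `m` and `n` in `Fin r` makes the index set finite and, through `m + n = r + 1`, also
  -- forces `m, n ≥ 2`.
  ⨆ (σ : Equiv.Perm (Fin r)) (m : Fin r) (n : Fin r) (i : Fin m)
    (h : (m : ℕ) + (n : ℕ) = r + 1),
    (Submodule.map₂ (P.comp i h) ⊤ ⊤).map (P.act σ)

theorem act_comp_mem_decomposables (P : NonunitalOperad.{u, w} k) {m n r : ℕ} (i : Fin m)
    (h : m + n = r + 1) (hm : 2 ≤ m) (hn : 2 ≤ n) (σ : Equiv.Perm (Fin r))
    (f : P.carrier m) (g : P.carrier n) : P.act σ (P.comp i h f g) ∈ P.decomposables r := by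
  have hmr : m < r := by omega
  have hnr : n < r := by omega
  have := Submodule.mem_map_of_mem (f := P.act σ)
    (Submodule.apply_mem_map₂ (P.comp i h) (Submodule.mem_top (x := f))
      (Submodule.mem_top (x := g)))
  unfold decomposables
  refine Submodule.mem_iSup_of_mem σ (Submodule.mem_iSup_of_mem ⟨m, hmr⟩
    (Submodule.mem_iSup_of_mem ⟨n, hnr⟩ (Submodule.mem_iSup_of_mem i
      (Submodule.mem_iSup_of_mem h this))))

/-- All permutations are already built into the definition, so a further `σ` only replaces the index
`τ` by `τ * σ` (a right action). -/
theorem act_mem_decomposables (P : NonunitalOperad.{u, w} k) {r : ℕ} (σ : Equiv.Perm (Fin r))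
    {x : P.carrier r} (hx : x ∈ P.decomposables r) : P.act σ x ∈ P.decomposables r := by
  suffices P.decomposables r ≤ (P.decomposables r).comap (P.act σ) from this hx
  conv_lhs => unfold decomposables
  refine iSup_le fun τ => iSup_le fun m => iSup_le fun n => iSup_le fun i => iSup_le fun h => ?_
  rw [Submodule.map_le_iff_le_comap, Submodule.map₂_le]
  intro f _ g _
  have hmul : P.act σ (P.act τ (P.comp i h f g)) = P.act (τ * σ) (P.comp i h f g) := by
    simp only [SigmaModule.act, MulOpposite.op_mul, map_mul, Module.End.mul_apply]
  rw [Submodule.mem_comap, Submodule.mem_comap, hmul]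
  have := m.isLt
  have := n.isLt
  exact P.act_comp_mem_decomposables i h (by omega) (by omega) _ f g

theorem decomposables_fg (P : NonunitalOperad.{u, w} k) {r : ℕ}
    (hP : ∀ m < r, Module.Finite k (P.carrier m)) : (P.decomposables r).FG := by
  unfold decomposables
  refine Submodule.fg_iSup _ fun σ => Submodule.fg_iSup _ fun m => Submodule.fg_iSup _ fun n =>
    Submodule.fg_iSup _ fun i => Submodule.fg_iSup _ fun h => ?_
  exact (Submodule.FG.map₂ _ (hP m m.isLt).fg_top (hP n n.isLt).fg_top).map _

end NonunitalOperad

/-! ### Values of formal expressions, and finiteness by induction on arity -/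

namespace SigmaModule

variable {k : Type u} [CommRing k]

/-- The values of expressions: `0` in arity `0`, multiples of the unit in arity `1`, and sums of
generators and decomposable elements in higher arities. -/
def valueSpan {E : SigmaModule.{u, v} k} {U : Prop} {P : NonunitalOperad.{u, w} k}
    (φ : SigmaModule.Hom E P.toSigmaModule) (e : U → P.carrier 1) :
    ∀ n : ℕ, Submodule k (P.carrier n)
  | 0 => ⊥
  | 1 => Submodule.span k (Set.range e)
  | n + 2 => LinearMap.range (φ.toFun (n + 2)) ⊔ P.decomposables (n + 2)

/-- The submodules `valueSpan` contain the generators and the unit and are closed under all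
operations, so structural induction on the expression applies. -/
theorem Formal.eval_mem_valueSpan {E : SigmaModule.{u, v} k} {U : Prop}
    {P : NonunitalOperad.{u, w} k} (h0 : Subsingleton (E.carrier 0))
    (h1 : Subsingleton (E.carrier 1))
    (φ : SigmaModule.Hom E P.toSigmaModule) (e : U → P.carrier 1)
    (he1 : ∀ (hU : U) {m : ℕ} (i : Fin m) (f : P.carrier m), P.comp i rfl f (e hU) = f)
    (he2 : ∀ (hU : U) {n : ℕ} (g : P.carrier n),
      P.comp (0 : Fin 1) (Nat.add_comm 1 n) (e hU) g = g)
    {n : ℕ} (f : Formal E U n) : Formal.eval φ e f ∈ valueSpan φ e n := by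
  have act_one : ∀ {n : ℕ} (x : P.carrier n), P.act 1 x = x := fun x => by
    simp only [SigmaModule.act, MulOpposite.op_one, map_one, Module.End.one_apply]
  induction f with
  | @of n x =>
    match n with
    | 0 => rw [Subsingleton.elim x 0]; simp [Formal.eval]
    | 1 => rw [Subsingleton.elim x 0]; simp [Formal.eval]
    | n + 2 => exact Submodule.mem_sup_left ⟨x, rfl⟩
  | one hU => exact Submodule.subset_span ⟨hU, rfl⟩
  | zero => exact Submodule.zero_mem _
  | add f g hf hg => exact Submodule.add_mem _ hf hg
  | smul c f hf => exact Submodule.smul_mem _ c hf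
  | @act n σ f hf =>
    match n with
    -- In arities 0 and 1 the symmetric group is trivial.
    | 0 => rw [Formal.eval, Subsingleton.elim σ 1, act_one]; exact hf
    | 1 => rw [Formal.eval, Subsingleton.elim σ 1, act_one]; exact hf
    | n + 2 =>
      obtain ⟨_, ⟨x, rfl⟩, y, hy, hxy⟩ := Submodule.mem_sup.1 hf
      rw [Formal.eval, ← hxy, map_add, ← φ.map_act]
      exact Submodule.add_mem _ (Submodule.mem_sup_left ⟨_, rfl⟩)
        (Submodule.mem_sup_right (P.act_mem_decomposables σ hy))
  | @comp m n r i h f g hf hg =>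
    rw [Formal.eval]
    match m, n with
    | 0, _ => exact i.elim0
    -- The inner value has arity 0, hence is zero, so no composite ever lowers the arity.
    | _, 0 =>
      rw [(Submodule.mem_bot k).1 hg, map_zero]
      exact Submodule.zero_mem _
    -- The outer value is a combination of units; by linearity and `e ∘ g = g` the composite is a
    -- multiple of the inner value.
    | 1, n =>
      obtain rfl : n = r := by omega
      obtain rfl : i = 0 := Subsingleton.elim _ _
      refine Submodule.span_induction ?_ ?_ ?_ ?_ hf
      · rintro _ ⟨hU, rfl⟩
        rw [he2]; exact hg
      · rw [map_zero]; exact Submodule.zero_mem _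
      · intro x y _ _ hx hy
        rw [map_add]; exact Submodule.add_mem _ hx hy
      · intro c x _ hx
        rw [map_smul]; exact Submodule.smul_mem _ c hx
    | m, 1 =>
      obtain rfl : m = r := by omega
      refine Submodule.span_induction ?_ ?_ ?_ ?_ hg
      · rintro _ ⟨hU, rfl⟩
        rw [he1]; exact hf
      · rw [map_zero]; exact Submodule.zero_mem _
      · intro x y _ _ hx hy
        rw [map_add]; exact Submodule.add_mem _ hx hy
      · intro c x _ hx
        rw [map_smul]; exact Submodule.smul_mem _ c hx
    | m + 2, n + 2 =>
      obtain ⟨r, rfl⟩ : ∃ s, r = s + 2 := ⟨r - 2, by omega⟩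
      -- Decomposables are defined as permuted composites, so the identity permutation is inserted.
      rw [← act_one (P.comp i h _ _)]
      exact Submodule.mem_sup_right
        (P.act_comp_mem_decomposables i h (by omega) (by omega) 1 _ _)

/-- A non-unital operad generated by a `Σ`-module that is finitely generated in each arity and
vanishes in arities `0` and `1`, possibly together with a unit, is finitely generated in each
arity. -/
theorem finite_of_eval_surjective {E : SigmaModule.{u, v} k} {U : Prop}
    {P : NonunitalOperad.{u, w} k} (h0 : Subsingleton (E.carrier 0))
    (h1 : Subsingleton (E.carrier 1)) (hfin : ∀ n : ℕ, 2 ≤ n → Module.Finite k (E.carrier n))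
    (φ : SigmaModule.Hom E P.toSigmaModule) (e : U → P.carrier 1)
    (he1 : ∀ (hU : U) {m : ℕ} (i : Fin m) (f : P.carrier m), P.comp i rfl f (e hU) = f)
    (he2 : ∀ (hU : U) {n : ℕ} (g : P.carrier n),
      P.comp (0 : Fin 1) (Nat.add_comm 1 n) (e hU) g = g)
    (hsurj : ∀ n, Function.Surjective (Formal.eval φ e : Formal E U n → P.carrier n)) (n : ℕ) :
    Module.Finite k (P.carrier n) := by
  induction n using Nat.strong_induction_on with
  | _ n ih =>
    have htop : valueSpan φ e n = ⊤ := by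
      refine (Submodule.eq_top_iff').2 fun x => ?_
      obtain ⟨f, rfl⟩ := hsurj n x
      exact f.eval_mem_valueSpan h0 h1 φ e he1 he2
    -- The whole arity-`n` component equals `valueSpan`, so it suffices that the latter is finitely
    -- generated.
    refine ⟨htop ▸ ?_⟩
    match n with
    | 0 => exact Submodule.fg_bot
    -- `U` is a proposition, so `e` has at most one value, and none in the non-unital case.
    | 1 => exact Submodule.fg_span (Set.finite_range e)
    | n + 2 =>
      have := hfin (n + 2) (by omega)
      refine Submodule.FG.sup ?_ (P.decomposables_fg ih)
      rw [LinearMap.range_eq_map]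
      exact this.fg_top.map _

/-! ### Application to the free operads -/

/-- The operations on classes are induced from those on expressions, so tautological evaluation is
the quotient map; its surjectivity is what the finiteness criterion needs. -/
theorem Formal.eval_ι (E : SigmaModule.{u, v} k) (U : Prop) {n : ℕ} (f : Formal E U n) :
    Formal.eval (P := FreeCarrier.nonunitalOperad E U) (FreeCarrier.ι E U)
      (fun hU => Quotient.mk (Formal.setoid E U 1) (Formal.one hU)) f =
      Quotient.mk (Formal.setoid E U n) f := by
  induction f with
  | of x => rfl
  | one hU => rfl
  | zero => rfl
  | add f g hf hg => exact congrArg₂ (· + ·) hf hg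
  | smul c f hf => exact congrArg (c • ·) hf
  | act σ f hf => exact congrArg ((FreeCarrier.sigmaModule E U).act σ) hf
  | comp i h f g hf hg =>
    exact congrArg₂ (fun x y => (FreeCarrier.nonunitalOperad E U).comp i h x y) hf hg

theorem FreeCarrier.finite {E : SigmaModule.{u, v} k} (U : Prop)
    (h0 : Subsingleton (E.carrier 0)) (h1 : Subsingleton (E.carrier 1))
    (hfin : ∀ n : ℕ, 2 ≤ n → Module.Finite k (E.carrier n)) (n : ℕ) :
    Module.Finite k ((FreeCarrier.nonunitalOperad E U).carrier n) := by
  refine finite_of_eval_surjective (P := FreeCarrier.nonunitalOperad E U) h0 h1 hfin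
    (FreeCarrier.ι E U)
    (fun hU => Quotient.mk (Formal.setoid E U 1) (Formal.one hU)) ?_ ?_ ?_ n
  · rintro hU m i ⟨f⟩
    exact Quotient.sound (Formal.Rel.comp_one hU i f)
  · rintro hU n ⟨g⟩
    exact Quotient.sound (Formal.Rel.one_comp hU g)
  · rintro n ⟨f⟩
    exact ⟨f, Formal.eval_ι E U f⟩

end SigmaModule

theorem mainTheorem7 {k : Type u} [CommRing k] (E : SigmaModule.{u, v} k)
    (h0 : Subsingleton (E.carrier 0)) (h1 : Subsingleton (E.carrier 1))
    (hfin : ∀ n : ℕ, 2 ≤ n → Module.Finite k (E.carrier n)) :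
    (∀ n : ℕ, Module.Finite k (E.freeNonunitalOperad.carrier n)) ∧
      (∀ n : ℕ, Module.Finite k (E.freeOperad.carrier n)) :=
  ⟨SigmaModule.FreeCarrier.finite False h0 h1 hfin, SigmaModule.FreeCarrier.finite True h0 h1 hfin⟩
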